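/- Let $M$ be a compact smooth manifold (Hausdorff, without boundary) of dimension $m$, let $X$ be a smooth vector field on $M$ with flow $\psi_t : M \to M$, $t\in\mathbb{R}$, and let $G : M \to \mathbb{R}$ be a smooth function. For $p \in M$ let $\gamma_p(t) = \psi_t(p)$, $t \in \mathbb{R}$, be the integral curve of $X$ through $p$, and let $g_p = G\circ\gamma_p : \mathbb{R}\to\mathbb{R}$ be the observation curve of $p$. For a $1$-form $\alpha$ on $M$ let $(\mathcal{L}_X\alpha)_p = \frac{d}{dt}\big|_{t=0} (\psi_t^*\alpha)_p$ denote the Lie derivative, and let $\mathcal{L}_X^j$ be its $j$-th iterate. For an integer $N > 0$ and $\tau > 0$ define the Takens map $\Psi_\tau^N : M \to \mathbb{R}^{N+1}$ by \[ \Psi_\tau^N(p) = \big(g_p(0), g_p(\tau), g_p(2\tau), \ldots, g_p(N\tau)\big). \] Assume the following two conditions. 1. For every $p \in M$ there is an $m$-tuple $J = (j_1,\dots,j_m) \in \mathbb{Z}_{\ge 0}^m$ such that the $m$-form $\mathcal{L}_X^{j_1}dG \wedge \cdots \wedge \mathcal{L}_X^{j_m}dG$ is nonzero at some point of the integral curve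 $\gamma_p$. 2. For any two distinct points $p, q \in M$ the observation curves $g_p$ and $g_q$ are not identical. Then there are an integer $N > 0$ and a real $\tau > 0$ such that $\Psi_\tau^N$ is a smooth embedding. -/

import Mathlib

open scoped Manifold ContDiff

namespace Takens

noncomputable section

/-- The type of (not necessarily continuous) vector fields on the `m`-manifold `M`. -/
abbrev VField (m : ℕ) (M : Type*) [TopologicalSpace M]
    [ChartedSpace (EuclideanSpace ℝ (Fin m)) M] : Type _ :=
  (p : M) → TangentSpace (𝓡 m) p

/-- The type of (not necessarily continuous) covector fields (1-forms) on the `m`-manifold `M`. -/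
abbrev OneForm (m : ℕ) (M : Type*) [TopologicalSpace M]
    [ChartedSpace (EuclideanSpace ℝ (Fin m)) M] : Type _ :=
  (p : M) → (TangentSpace (𝓡 m) p →L[ℝ] ℝ)

variable {m : ℕ} {M : Type*} [TopologicalSpace M] [ChartedSpace (EuclideanSpace ℝ (Fin m)) M]

open scoped Classical in
/-- The flow `ψ_t(p) = γ_p(t)` of a complete vector field `X`: here `γ_p` is the integral curve
of `X`, defined on all of `ℝ`, that starts at `p`. For a smooth vector field on a compact
Hausdorff manifold without boundary such a curve exists and is unique, for every `p`.
(If there were no such curve, the value would be `p`.) -/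
def flow (X : VField m M) (t : ℝ) (p : M) : M :=
  if h : ∃ γ : ℝ → M, γ 0 = p ∧ IsMIntegralCurve γ X then h.choose t else p

/-- The Lie derivative of a 1-form `α` along `X`: at `p`, it is the derivative at `t = 0` of the
curve `t ↦ (ψ_t^* α)_p = α_{ψ_t(p)} ∘ (dψ_t)_p` in the cotangent space at `p`. -/
def lieDeriv (X : VField m M) (α : OneForm m M) : OneForm m M := fun p =>
  deriv (fun t : ℝ => (α (flow X t p)).comp (mfderiv (𝓡 m) (𝓡 m) (flow X t) p)) 0

/-- The iterated Lie derivative `L_X^j dG` of the differential of `G`. -/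
def iterLieDeriv (X : VField m M) (G : M → ℝ) (j : ℕ) : OneForm m M :=
  (lieDeriv X)^[j] (fun p => mvfderiv (𝓡 m) G p)

/-- The value at `p` of the `m`-form `⋀_{j ∈ J} L_X^j dG`, where `J = (j_1, …, j_m)`, as an element
of the `m`-th exterior power of the cotangent space at `p`. -/
def wedgeLieDeriv (X : VField m M) (G : M → ℝ) (J : Fin m → ℕ) (p : M) :
    ⋀[ℝ]^m (TangentSpace (𝓡 m) p →L[ℝ] ℝ) :=
  exteriorPower.ιMulti ℝ m (fun k => iterLieDeriv X G (J k) p)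

/-- The observation curve `g_p = G ∘ γ_p`. -/
def observationCurve (X : VField m M) (G : M → ℝ) (p : M) : ℝ → ℝ :=
  fun t => G (flow X t p)

/-- The Takens map `Ψ_τ^N(p) = (g_p(0), g_p(τ), …, g_p(N τ))`. -/
def takensMap (X : VField m M) (G : M → ℝ) (τ : ℝ) (N : ℕ) (p : M) :
    EuclideanSpace ℝ (Fin (N + 1)) :=
  WithLp.toLp 2 (fun k : Fin (N + 1) => observationCurve X G p ((k : ℕ) * τ))

end

end Takens

/-! Condition 2 says that the functions `G ∘ ψ_t`, for real `t`, separate points. Condition 1 makes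
them separate tangent vectors: if every `d(G ∘ ψ_t)` kills `v` at `p`, then differentiating in `t`
shows that every `L_X^j dG` kills `dψ_s(v)` at `ψ_s(p)`, for all `s`. A nonzero wedge of `m`
covectors has trivial common kernel, so `dψ_s(v) = 0`, and `v = 0` because `ψ_s` is invertible
(`exists_mvfderiv_comp_flow_ne_zero`).

By compactness, finitely many sufficiently dense times already separate points and tangent vectors
(`eventually_forall_sample_separates`). Away from the diagonal this is continuity; near the diagonal
it is strict differentiability, uniform over the unit sphere of directions. For large `n` the times
`k/n - n` with `0 ≤ k ≤ 2n²` suffice, and replacing `p` by `ψ_n(p)` shifts them to `k/n`. Hence `τ =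
1/n` and `N = 2n²` give an injective immersion of a compact space, which is an embedding.

Two general facts support this: smoothness of the flow (`contMDiff_flow`), from the implicit
function theorem applied to the integral equation, and the local normal form of immersions
(`isImmersion_of_injective_mfderiv`). -/

open Set Filter Topology

universe u

/-! ### Smoothness of composition operators on spaces of continuous maps -/

section Superposition

variable {K : Type*} [TopologicalSpace K] [CompactSpace K]

/-- Pointwise application of a continuous family of continuous linear maps to a continuous map. -/
noncomputable def ContinuousMap.pointwiseApplyL {E F : Type*} [NormedAddCommGroup E]
    [NormedSpace ℝ E] [NormedAddCommGroup F] [NormedSpace ℝ F] :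
    C(K, E →L[ℝ] F) →L[ℝ] C(K, E) →L[ℝ] C(K, F) :=
  LinearMap.mkContinuous₂
    (LinearMap.mk₂ ℝ (fun (A : C(K, E →L[ℝ] F)) (v : C(K, E)) =>
        (⟨fun t => A t (v t), by fun_prop⟩ : C(K, F)))
      (fun A B v => by ext t; simp) (fun c A v => by ext t; simp)
      (fun A v w => by ext t; simp) (fun c A v => by ext t; simp))
    1 (fun A v => by
      rw [one_mul]
      refine (ContinuousMap.norm_le _ (by positivity)).2 fun t => ?_
      exact (A t).le_of_opNorm_le_of_le (A.norm_coe_le_norm t) (v.norm_coe_le_norm t))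

@[simp]
theorem ContinuousMap.pointwiseApplyL_apply {E F : Type*} [NormedAddCommGroup E]
    [NormedSpace ℝ E] [NormedAddCommGroup F] [NormedSpace ℝ F]
    (A : C(K, E →L[ℝ] F)) (v : C(K, E)) (t : K) :
    ContinuousMap.pointwiseApplyL A v t = A t (v t) := rfl

/-- The mean value inequality at each `t` gives the linear approximation; continuity of `η ↦ f' ∘ η`
in the sup norm makes it uniform in `t`. -/
theorem ContinuousMap.hasFDerivAt_postcomp {E F : Type*} [NormedAddCommGroup E]
    [NormedSpace ℝ E] [NormedAddCommGroup F] [NormedSpace ℝ F]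
    (f : C(E, F)) (f' : C(E, E →L[ℝ] F)) (hf : ∀ x, HasFDerivAt f (f' x) x) (γ : C(K, E)) :
    HasFDerivAt (fun η : C(K, E) => f.comp η) (ContinuousMap.pointwiseApplyL (f'.comp γ)) γ := by
  rw [hasFDerivAt_iff_isLittleO, Asymptotics.isLittleO_iff]
  intro ε hε
  have hcont : ContinuousAt (fun η : C(K, E) => f'.comp η) γ :=
    (ContinuousMap.continuous_postcomp f').continuousAt
  obtain ⟨δ, hδ, hball⟩ := Metric.eventually_nhds_iff.1
    (hcont.eventually (Metric.ball_mem_nhds (f'.comp γ) hε))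
  filter_upwards [Metric.ball_mem_nhds γ hδ] with η hη
  refine (ContinuousMap.norm_le _ (by positivity)).2 fun t => ?_
  have hbound : ∀ y ∈ Metric.ball (γ t) δ, ‖f' y - f' (γ t)‖ ≤ ε := by
    intro y hy
    -- Shifting `γ` by the constant `y - γ t` gives a curve through `y` at sup distance less than
    -- `δ`, so one `δ` serves all `t`.
    have hd : dist (γ + ContinuousMap.const K (y - γ t)) γ < δ := by
      rw [dist_eq_norm, add_sub_cancel_left]
      refine (ContinuousMap.norm_lt_iff _ hδ).2 fun s => ?_
      simpa [dist_eq_norm] using hy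
    have h1 := hball hd
    have h2 := (ContinuousMap.dist_apply_le_dist t).trans h1.le
    simpa [dist_eq_norm] using h2
  have hmem : η t ∈ Metric.ball (γ t) δ :=
    lt_of_le_of_lt (ContinuousMap.dist_apply_le_dist t) hη
  have h3 := Convex.norm_image_sub_le_of_norm_hasFDerivWithin_le' (𝕜 := ℝ) (f := f)
    (fun x _ => (hf x).hasFDerivWithinAt) hbound (convex_ball _ _) (Metric.mem_ball_self hδ) hmem
  refine h3.trans ?_
  gcongr
  exact (η - γ).norm_coe_le_norm t

/-- The derivative is again postcomposition, by `f'`, followed by a bounded linear map, so induction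
applies. The induction replaces `F` by `E →L[ℝ] F`, hence the common universe. -/
theorem ContinuousMap.contDiff_postcomp_nat {E : Type u} [NormedAddCommGroup E]
    [NormedSpace ℝ E] (n : ℕ) : ∀ {F : Type u} [NormedAddCommGroup F] [NormedSpace ℝ F]
    (f : C(E, F)), ContDiff ℝ n f → ContDiff ℝ n (fun η : C(K, E) => f.comp η) := by
  induction n with
  | zero =>
    intro F _ _ f _
    rw [Nat.cast_zero, contDiff_zero]
    exact ContinuousMap.continuous_postcomp f
  | succ n ih =>
    intro F _ _ f hf
    rw [Nat.cast_succ, contDiff_succ_iff_hasFDerivAt] at hf ⊢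
    obtain ⟨f', hf', hff'⟩ := hf
    exact ⟨_, ContinuousMap.pointwiseApplyL.contDiff.comp (ih ⟨f', hf'.continuous⟩ hf'),
      ContinuousMap.hasFDerivAt_postcomp f ⟨f', hf'.continuous⟩ hff'⟩

/-- Composition with a smooth map is a smooth map between spaces of continuous functions. -/
theorem ContinuousMap.contDiff_postcomp {E F : Type u} [NormedAddCommGroup E]
    [NormedSpace ℝ E] [NormedAddCommGroup F] [NormedSpace ℝ F]
    (f : C(E, F)) (hf : ContDiff ℝ ∞ f) : ContDiff ℝ ∞ (fun η : C(K, E) => f.comp η) :=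
  contDiff_infty.2 fun n => ContinuousMap.contDiff_postcomp_nat n f (contDiff_infty.1 hf n)

end Superposition

/-! ### Smooth dependence of solutions in a Banach space -/

section LocalFlow

variable {E : Type u} [NormedAddCommGroup E] [NormedSpace ℝ E]

/-- The primitive, vanishing at `0`, of a continuous function on `[-1, 1]`. -/
noncomputable def ContinuousMap.primitiveL [CompleteSpace E] :
    C(Icc (-1 : ℝ) 1, E) →L[ℝ] C(Icc (-1 : ℝ) 1, E) :=
  LinearMap.mkContinuous
    { toFun := fun g => ⟨fun r => ∫ u in (0 : ℝ)..r, IccExtend (by norm_num) g u, by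
        have := intervalIntegral.continuous_primitive (μ := MeasureTheory.volume)
          (f := IccExtend (by norm_num : (-1 : ℝ) ≤ 1) g)
          (fun a b => (g.continuous.Icc_extend' (h := by norm_num)).intervalIntegrable a b) 0
        exact this.comp continuous_subtype_val⟩
      map_add' := fun g h => by
        ext r
        exact intervalIntegral.integral_add
          ((g.continuous.Icc_extend' (h := by norm_num)).intervalIntegrable _ _)
          ((h.continuous.Icc_extend' (h := by norm_num)).intervalIntegrable _ _)
      map_smul' := fun c g => by
        ext r
        exact intervalIntegral.integral_smul c _ }
    1 (fun g => by
      rw [one_mul]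
      refine (ContinuousMap.norm_le _ (by positivity)).2 fun r => ?_
      refine (intervalIntegral.norm_integral_le_of_norm_le_const (C := ‖g‖)
        fun x _ => g.norm_coe_le_norm _).trans ?_
      have : |(r : ℝ) - 0| ≤ 1 := by rw [sub_zero, abs_le]; exact r.2
      nlinarith [norm_nonneg g])

theorem ContinuousMap.primitiveL_apply [CompleteSpace E] (g : C(Icc (-1 : ℝ) 1, E))
    (r : Icc (-1 : ℝ) 1) : ContinuousMap.primitiveL g r =
      ∫ u in (0 : ℝ)..r, IccExtend (by norm_num) g u := rfl

/-- Near a point `x₀` and time `0`, the solutions of `γ' = s • f γ`, `γ 0 = x` on `(-1, 1)` form a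
family which is smooth in `(x, s)`. -/
theorem exists_contDiffAt_solution [CompleteSpace E] (f : E → E) (hf : ContDiff ℝ ∞ f) (x₀ : E) :
    ∃ Γ : E × ℝ → C(Icc (-1 : ℝ) 1, E), ContDiffAt ℝ ∞ Γ (x₀, 0) ∧
      Γ (x₀, 0) = ContinuousMap.const _ x₀ ∧
      ∀ᶠ z in 𝓝 (x₀, (0 : ℝ)), Γ z ⟨0, by norm_num, by norm_num⟩ = z.1 ∧
        ∀ r ∈ Ioo (-1 : ℝ) 1, HasDerivAt (IccExtend (by norm_num) (Γ z))
          (z.2 • f (IccExtend (by norm_num) (Γ z) r)) r := by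
  let fc : C(E, E) := ⟨f, hf.continuous⟩
  let cst : E →L[ℝ] C(Icc (-1 : ℝ) 1, E) := ContinuousLinearMap.const ℝ _
  -- Zeros are the solutions of `γ = x + s ∫ f(γ)`. At `s = 0` the integral disappears, so the
  -- partial derivative in `γ` is the identity and the implicit function theorem needs no smallness
  -- estimate.
  let Ff : (E × ℝ) × C(Icc (-1 : ℝ) 1, E) → C(Icc (-1 : ℝ) 1, E) := fun y =>
    y.2 - cst y.1.1 - y.1.2 • ContinuousMap.primitiveL (fc.comp y.2)
  have hpost := ContinuousMap.contDiff_postcomp (K := Icc (-1 : ℝ) 1) fc hf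
  have hFf : ContDiff ℝ ∞ Ff := by
    refine (contDiff_snd.sub (cst.contDiff.comp (contDiff_fst.comp contDiff_fst))).sub ?_
    exact (contDiff_snd.comp contDiff_fst).smul
      (ContinuousMap.primitiveL.contDiff.comp (hpost.comp contDiff_snd))
  let u : (E × ℝ) × C(Icc (-1 : ℝ) 1, E) := ((x₀, 0), cst x₀)
  have hu : Ff u = 0 := by simp [Ff, u]
  have hder : fderiv ℝ Ff u ∘L .inr ℝ (E × ℝ) C(Icc (-1 : ℝ) 1, E) = .id ℝ _ := by
    have h1 : HasFDerivAt (Ff ∘ fun η => ((x₀, (0 : ℝ)), η))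
        (fderiv ℝ Ff u ∘L .inr ℝ (E × ℝ) C(Icc (-1 : ℝ) 1, E)) (cst x₀) :=
      HasFDerivAt.comp (cst x₀) ((hFf.differentiable (by simp)) u).hasFDerivAt
        (hasFDerivAt_prodMk_right _ _)
    have h2 : (Ff ∘ fun η => ((x₀, (0 : ℝ)), η)) = fun η => η - cst x₀ := by
      ext1 η; simp [Ff]
    rw [h2] at h1
    exact h1.unique ((hasFDerivAt_id _).sub_const _)
  have hinv : (fderiv ℝ Ff u ∘L .inr ℝ (E × ℝ) C(Icc (-1 : ℝ) 1, E)).IsInvertible := by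
    rw [hder]; exact ⟨.refl ℝ _, rfl⟩
  have hcd : ContDiffAt ℝ ∞ Ff u := hFf.contDiffAt
  refine ⟨hcd.implicitFunction (by simp) hinv, hcd.contDiffAt_implicitFunction (by simp) hinv,
    hcd.implicitFunction_apply_self (by simp) hinv, ?_⟩
  filter_upwards [hcd.eventually_apply_implicitFunction (by simp) hinv] with z hz
  set γ := hcd.implicitFunction (by simp) hinv z
  rw [hu] at hz
  have hγ : ∀ r : Icc (-1 : ℝ) 1, γ r =
      z.1 + z.2 • ∫ u in (0 : ℝ)..r, IccExtend (by norm_num) (fc.comp γ) u := by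
    intro r
    have := congrArg (fun g : C(Icc (-1 : ℝ) 1, E) => g r) hz
    simp only [Ff, ContinuousMap.sub_apply, ContinuousMap.smul_apply,
      ContinuousMap.primitiveL_apply, ContinuousMap.zero_apply] at this
    rw [sub_sub, sub_eq_zero] at this
    exact this
  refine ⟨by rw [hγ]; simp, fun r hr => ?_⟩
  have hcont : Continuous (IccExtend (by norm_num : (-1 : ℝ) ≤ 1) (fc.comp γ)) :=
    (fc.comp γ).continuous.Icc_extend'
  have hd : HasDerivAt (fun r => z.1 + z.2 • ∫ u in (0 : ℝ)..r,
      IccExtend (by norm_num : (-1 : ℝ) ≤ 1) (fc.comp γ) u)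
      (z.2 • IccExtend (by norm_num : (-1 : ℝ) ≤ 1) (fc.comp γ) r) r :=
    ((hcont.integral_hasStrictDerivAt 0 r).hasDerivAt.const_smul z.2).const_add z.1
  refine hd.congr_of_eventuallyEq ?_
  filter_upwards [Ioo_mem_nhds hr.1 hr.2] with r' hr'
  rw [IccExtend_of_mem _ _ (Ioo_subset_Icc_self hr'), hγ]

end LocalFlow

/-! ### The local flow on a manifold, through a chart -/

section ChartFlow

variable {E : Type*} [NormedAddCommGroup E] [NormedSpace ℝ E]
  {H : Type*} [TopologicalSpace H] {I : ModelWithCorners ℝ E H} [I.Boundaryless]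
  {M : Type*} [TopologicalSpace M] [ChartedSpace H M]

/-- A curve in a chart which solves the ODE of a vector field written in that chart gives an
integral curve on the manifold. -/
theorem hasMFDerivAt_extChartAt_symm_comp [IsManifold I 1 M] {c : ℝ → E} {t : ℝ} {p₀ q : M}
    (hc : c t ∈ (extChartAt I p₀).target) (hq : (extChartAt I p₀).symm (c t) = q)
    {v : TangentSpace I q} (h : HasDerivAt c (tangentCoordChange I q p₀ q v) t) :
    HasMFDerivAt 𝓘(ℝ, ℝ) I ((extChartAt I p₀).symm ∘ c) t ((1 : ℝ →L[ℝ] ℝ).smulRight v) := by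
  have hft1 : q ∈ (extChartAt I p₀).source := hq ▸ (extChartAt I p₀).map_target hc
  have hft2 := mem_extChartAt_source (I := I) q
  have hcq : extChartAt I p₀ q = c t := hq ▸ (extChartAt I p₀).right_inv hc
  have h1 := hasFDerivWithinAt_tangentCoordChange (I := I) (x := p₀) (y := q) (z := q) ⟨hft1, hft2⟩
  rw [hcq, I.range_eq_univ, hasFDerivWithinAt_univ] at h1
  have h2 := (h1.comp_hasDerivAt t h).congr_deriv
    ((tangentCoordChange_comp ⟨⟨hft2, hft1⟩, hft2⟩).trans (tangentCoordChange_self hft2))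
  refine ⟨(continuousAt_extChartAt_symm'' hc).comp h.continuousAt, ?_⟩
  have h3 : HasFDerivWithinAt ((extChartAt I q ∘ (extChartAt I p₀).symm) ∘ c)
      (ContinuousLinearMap.toSpanSingleton ℝ (id v : E)) univ t :=
    h2.hasFDerivAt.hasFDerivWithinAt
  rw [← ContinuousLinearMap.smulRight_one_eq_toSpanSingleton] at h3
  simp only [mfld_simps]
  change HasFDerivWithinAt
    ((extChartAt I ((extChartAt I p₀).symm (c t)) ∘ (extChartAt I p₀).symm) ∘ c) _ univ t
  rw [hq]
  exact h3

/-- The vector field `X` written in the chart at `p₀`. -/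
noncomputable def chartVectorField (X : (p : M) → TangentSpace I p) [IsManifold I 1 M] (p₀ : M)
    (x : E) : E :=
  tangentCoordChange I ((extChartAt I p₀).symm x) p₀ ((extChartAt I p₀).symm x)
    (X ((extChartAt I p₀).symm x))

theorem contDiffAt_chartVectorField [IsManifold I ∞ M] [IsManifold I 1 M]
    {X : (p : M) → TangentSpace I p}
    (hX : ContMDiff I I.tangent ∞ (fun p => (⟨p, X p⟩ : TangentBundle I M)))
    (p₀ : M) {x : E} (hx : x ∈ (extChartAt I p₀).target) :
    ContDiffAt ℝ ∞ (chartVectorField X p₀) x := by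
  rw [← contMDiffAt_iff_contDiffAt]
  have hq := (extChartAt I p₀).map_target hx
  rw [extChartAt_source] at hq
  have h1 : ContMDiffAt I 𝓘(ℝ, E) ∞ (fun p => (trivializationAt E (TangentSpace I) p₀
      ⟨p, X p⟩).2) ((extChartAt I p₀).symm x) :=
    (Bundle.Trivialization.contMDiffAt_section_iff (trivializationAt E (TangentSpace I) p₀) hq).1 (hX _)
  have h2 : ContMDiffAt 𝓘(ℝ, E) I ∞ (extChartAt I p₀).symm x :=
    (contMDiffOn_extChartAt_symm p₀).contMDiffAt (extChartAt_target_mem_nhds' hx)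
  exact h1.comp x h2

/-- Time is traded for speed: the curve of `2t • X` on the fixed interval `(-1, 1)`, read at the
interior point `1/2`, has followed `X` for time `t`. -/
theorem exists_localFlow [CompleteSpace E] [FiniteDimensional ℝ E] [IsManifold I ∞ M] [IsManifold I 1 M]
    {X : (p : M) → TangentSpace I p}
    (hX : ContMDiff I I.tangent ∞ (fun p => (⟨p, X p⟩ : TangentBundle I M))) (p₀ : M) :
    ∃ Φ : ℝ × M → M, ContMDiffAt (𝓘(ℝ, ℝ).prod I) I ∞ Φ (0, p₀) ∧
      ∀ᶠ z in 𝓝 ((0 : ℝ), p₀), ∃ γ : ℝ → M, γ 0 = z.2 ∧ γ (1 / 2) = Φ z ∧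
        IsMIntegralCurveOn γ ((2 * z.1) • X) (Ioo (-1) 1) := by
  set φ := extChartAt I p₀ with hφ
  set x₀ := φ p₀
  obtain ⟨r, hr, hball⟩ := Metric.nhds_basis_closedBall.mem_iff.1
    (extChartAt_target_mem_nhds (I := I) p₀)
  -- The cutoff makes the chart field globally smooth without changing it within `r / 2` of `x₀`;
  -- `hev1` keeps the solutions in that ball.
  let χ : ContDiffBump x₀ := ⟨r / 2, r, by positivity, by linarith⟩
  let f : E → E := fun x => χ x • chartVectorField X p₀ x
  have hf : ContDiff ℝ ∞ f := by
    refine contMDiff_iff_contDiff.1 (contMDiff_of_tsupport fun x hx => ContDiffAt.contMDiffAt ?_)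
    have hx' : x ∈ tsupport χ := closure_mono (Function.support_smul_subset_left _ _) hx
    rw [χ.tsupport_eq] at hx'
    exact χ.contDiff.contDiffAt.smul (contDiffAt_chartVectorField hX p₀ (hball hx'))
  obtain ⟨Γ, hΓ, hΓ0, hev⟩ := exists_contDiffAt_solution f hf x₀
  let L : ℝ × M → E × ℝ := fun z => (φ z.2, 2 * z.1)
  have hL0 : L (0, p₀) = (x₀, 0) := by simp [L, x₀]
  have hL : ContMDiffAt (𝓘(ℝ, ℝ).prod I) 𝓘(ℝ, E × ℝ) ∞ L (0, p₀) := by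
    refine ContMDiffAt.prodMk_space ?_ ?_
    · exact (contMDiffAt_extChartAt (I := I) (n := ∞) (x := p₀)).comp ((0 : ℝ), p₀) contMDiffAt_snd
    · exact contMDiffAt_const.mul contMDiffAt_fst
  have hev1 : ∀ᶠ w in 𝓝 (x₀, (0 : ℝ)), ∀ s, Γ w s ∈ Metric.ball x₀ (r / 2) := by
    have h1 : ∀ᶠ w in 𝓝 (x₀, (0 : ℝ)), dist (Γ w) (Γ (x₀, 0)) < r / 2 :=
      hΓ.continuousAt.eventually (Metric.ball_mem_nhds _ (by positivity))
    filter_upwards [h1] with w hw s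
    have := (ContinuousMap.dist_apply_le_dist s).trans_lt hw
    rwa [hΓ0] at this
  have hhalf : (1 / 2 : ℝ) ∈ Icc (-1 : ℝ) 1 := by norm_num
  refine ⟨fun z => φ.symm (Γ (L z) ⟨1 / 2, hhalf⟩), ?_, ?_⟩
  · have h1 : ContMDiffAt (𝓘(ℝ, ℝ).prod I) 𝓘(ℝ, E) ∞ (fun z => Γ (L z) ⟨1 / 2, hhalf⟩) (0, p₀) := by
      have h2 : ContDiffAt ℝ ∞ (fun w => Γ w ⟨1 / 2, hhalf⟩) (L (0, p₀)) := by
        rw [hL0]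
        exact (ContinuousMap.evalCLM ℝ (⟨1 / 2, hhalf⟩ : Icc (-1 : ℝ) 1)).contDiff.contDiffAt.comp
          _ hΓ
      exact h2.contMDiffAt.comp _ hL
    have h3 : Γ (L (0, p₀)) ⟨1 / 2, hhalf⟩ = x₀ := by rw [hL0, hΓ0]; rfl
    have h4 : ContMDiffAt 𝓘(ℝ, E) I ∞ φ.symm (Γ (L (0, p₀)) ⟨1 / 2, hhalf⟩) := by
      rw [h3]
      exact (contMDiffOn_extChartAt_symm p₀).contMDiffAt (extChartAt_target_mem_nhds p₀)
    exact ContMDiffAt.comp (0, p₀) h4 h1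
  · have hLt : Tendsto L (𝓝 (0, p₀)) (𝓝 (x₀, 0)) := by
      have := hL.continuousAt.tendsto
      rwa [hL0] at this
    have hsrc : ∀ᶠ z in 𝓝 ((0 : ℝ), p₀), z.2 ∈ φ.source :=
      continuousAt_snd.eventually (extChartAt_source_mem_nhds (I := I) p₀)
    filter_upwards [hLt.eventually hev, hLt.eventually hev1, hsrc] with z hz hz1 hz2
    have hcI : ∀ t ∈ Ioo (-1 : ℝ) 1, IccExtend (by norm_num : (-1 : ℝ) ≤ 1) (Γ (L z)) t ∈
      Metric.ball x₀ (r / 2) := fun t ht => hz1 _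
    refine ⟨φ.symm ∘ IccExtend (by norm_num : (-1 : ℝ) ≤ 1) (Γ (L z)), ?_, ?_, fun t ht => ?_⟩
    · rw [Function.comp_apply, IccExtend_of_mem _ _ (by norm_num), hz.1]
      exact φ.left_inv hz2
    · rw [Function.comp_apply, IccExtend_of_mem _ _ hhalf]
    · refine (hasMFDerivAt_extChartAt_symm_comp ?_ rfl ?_).hasMFDerivWithinAt
      · exact hball (Metric.ball_subset_closedBall (Metric.ball_subset_ball (by linarith) (hcI t ht)))
      · have := hz.2 t ht
        simp only [f] at this
        rw [χ.one_of_mem_closedBall (Metric.ball_subset_closedBall (hcI t ht)), one_smul] at this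
        exact this.congr_deriv (map_smul (tangentCoordChange I _ p₀ _) (2 * z.1) _).symm

end ChartFlow

/-! ### The global flow and its smoothness -/

namespace Takens

section Flow

variable {m : ℕ} {M : Type*} [TopologicalSpace M] [T2Space M] [CompactSpace M]
  [ChartedSpace (EuclideanSpace ℝ (Fin m)) M] [IsManifold (𝓡 m) ∞ M]
  {X : (p : M) → TangentSpace (𝓡 m) p}

/-- Compactness gives one `ε` for all starting points. A curve of `ε • X` on `(-1, 1)` rescales to
one of `X` on `(-ε, ε)`, and a uniform existence time yields global curves. -/
theorem exists_isMIntegralCurve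
    (hX : ContMDiff (𝓡 m) (𝓡 m).tangent ∞ (fun p => (⟨p, X p⟩ : TangentBundle (𝓡 m) M))) (p : M) :
    ∃ γ : ℝ → M, γ 0 = p ∧ IsMIntegralCurve γ X := by
  have h1 : ∀ᶠ t in 𝓝 (0 : ℝ), ∀ q ∈ (univ : Set M), ∃ γ : ℝ → M, γ 0 = q ∧
      IsMIntegralCurveOn γ ((2 * t) • X) (Ioo (-1) 1) := by
    refine isCompact_univ.eventually_forall_of_forall_eventually fun q _ => ?_
    obtain ⟨Φ, -, hΦ⟩ := exists_localFlow hX q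
    filter_upwards [hΦ] with z ⟨γ, hγ0, _, hγ⟩ using ⟨γ, hγ0, hγ⟩
  obtain ⟨ε, hε, h2⟩ := Metric.eventually_nhds_iff.1 h1
  have hε2 : dist (ε / 2) 0 < ε := by
    rw [Real.dist_eq, sub_zero, abs_of_pos (by positivity)]; linarith
  refine exists_isMIntegralCurve_of_isMIntegralCurveOn (hX.of_le (by simp)) hε (fun q => ?_) p
  obtain ⟨γ, hγ0, hγ⟩ := h2 hε2 q (mem_univ q)
  refine ⟨γ ∘ (· * ε⁻¹), by simpa using hγ0, ?_⟩
  have h3 := hγ.comp_mul ε⁻¹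
  rw [smul_smul, mul_div_cancel₀ _ two_ne_zero, inv_mul_cancel₀ hε.ne', one_smul] at h3
  refine h3.mono fun t ht => ?_
  simp only [mem_ofPred_eq, mem_Ioo, ← div_eq_mul_inv]
  rw [lt_div_iff₀ hε, div_lt_iff₀ hε]
  constructor <;> linarith [ht.1, ht.2]

theorem flow_spec
    (hX : ContMDiff (𝓡 m) (𝓡 m).tangent ∞ (fun p => (⟨p, X p⟩ : TangentBundle (𝓡 m) M))) (p : M) :
    flow X 0 p = p ∧ IsMIntegralCurve (fun t => flow X t p) X := by
  have h := exists_isMIntegralCurve hX p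
  have h1 : (fun t => flow X t p) = h.choose := by
    funext t
    simp only [flow, dif_pos h]
  exact ⟨(congrFun h1 0).trans h.choose_spec.1, h1 ▸ h.choose_spec.2⟩

theorem flow_zero
    (hX : ContMDiff (𝓡 m) (𝓡 m).tangent ∞ (fun p => (⟨p, X p⟩ : TangentBundle (𝓡 m) M))) (p : M) :
    flow X 0 p = p := (flow_spec hX p).1

theorem flow_add
    (hX : ContMDiff (𝓡 m) (𝓡 m).tangent ∞ (fun p => (⟨p, X p⟩ : TangentBundle (𝓡 m) M)))
    (s t : ℝ) (p : M) : flow X (s + t) p = flow X s (flow X t p) := by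
  have h1 := (flow_spec hX p).2.comp_add t
  have h2 := (flow_spec hX (flow X t p)).2
  have := isMIntegralCurve_Ioo_eq_of_contMDiff_boundaryless (t₀ := 0) (hX.of_le (by simp)) h1 h2
    (by simp [flow_zero hX])
  exact congrFun this s

/-- Uniqueness of integral curves identifies the flow with the smooth local flow near time `0`. -/
theorem contMDiffAt_flow_zero
    (hX : ContMDiff (𝓡 m) (𝓡 m).tangent ∞ (fun p => (⟨p, X p⟩ : TangentBundle (𝓡 m) M))) (p : M) :
    ContMDiffAt (𝓘(ℝ, ℝ).prod (𝓡 m)) (𝓡 m) ∞ (fun z : ℝ × M => flow X z.1 z.2) (0, p) := by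
  obtain ⟨Φ, hΦs, hΦ⟩ := exists_localFlow hX p
  refine hΦs.congr_of_eventuallyEq ?_
  filter_upwards [hΦ] with z ⟨γ, hγ0, hγ1, hγ⟩
  have h1 : IsMIntegralCurveOn ((fun t => flow X t z.2) ∘ (· * (2 * z.1))) ((2 * z.1) • X)
      (Ioo (-1) 1) := (((flow_spec hX z.2).2).comp_mul (2 * z.1)).isMIntegralCurveOn _
  have hX1 : ContMDiff (𝓡 m) (𝓡 m).tangent 1
      (fun p => (⟨p, ((2 * z.1) • X) p⟩ : TangentBundle (𝓡 m) M)) :=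
    ContMDiff.const_smul_section (hX.of_le (by simp))
  have h2 := isMIntegralCurveOn_Ioo_eqOn_of_contMDiff_boundaryless (t₀ := 0) (by norm_num) hX1
    h1 hγ (by simp [flow_zero hX, hγ0])
  have h3 := h2 (show (1 / 2 : ℝ) ∈ Ioo (-1 : ℝ) 1 by norm_num)
  rw [hγ1] at h3
  rw [← h3]
  simp

/-- The flow of a smooth vector field on a compact manifold is smooth. -/
theorem contMDiff_flow
    (hX : ContMDiff (𝓡 m) (𝓡 m).tangent ∞ (fun p => (⟨p, X p⟩ : TangentBundle (𝓡 m) M))) :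
    ContMDiff (𝓘(ℝ, ℝ).prod (𝓡 m)) (𝓡 m) ∞ (fun z : ℝ × M => flow X z.1 z.2) := by
  -- Being `C^n` at a point is an open condition only for finite `n`; openness and compactness give
  -- smoothness on a whole slab of small times. Large times follow by iterating the flow of time `t
  -- / (k + 1)`.
  rw [contMDiff_infty]
  intro n
  have h1 : ∀ᶠ t in 𝓝 (0 : ℝ), ∀ q ∈ (univ : Set M),
      ContMDiffAt (𝓘(ℝ, ℝ).prod (𝓡 m)) (𝓡 m) n (fun z : ℝ × M => flow X z.1 z.2) (t, q) := by
    refine isCompact_univ.eventually_forall_of_forall_eventually fun q _ => ?_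
    exact (contMDiffAt_iff_contMDiffAt_nhds (by simp)).1
      ((contMDiffAt_flow_zero hX q).of_le (by exact_mod_cast le_top))
  have h2 : ∀ t : ℝ, (∀ q : M, ContMDiffAt (𝓘(ℝ, ℝ).prod (𝓡 m)) (𝓡 m) n
      (fun z : ℝ × M => flow X z.1 z.2) (t, q)) → ∀ k : ℕ, ∀ q : M,
      ContMDiffAt (𝓘(ℝ, ℝ).prod (𝓡 m)) (𝓡 m) n
        (fun z : ℝ × M => flow X (k * z.1) z.2) (t, q) := by
    intro t ht k q
    induction k with
    | zero => simpa [flow_zero hX] using contMDiffAt_snd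
    | succ k ih =>
      have : (fun z : ℝ × M => flow X ((k + 1 : ℕ) * z.1) z.2) =
          (fun z : ℝ × M => flow X z.1 z.2) ∘ fun z : ℝ × M => (z.1, flow X (k * z.1) z.2) := by
        funext z
        rw [Function.comp_apply, ← flow_add hX]
        congr 1; push_cast; ring
      rw [this]
      exact ContMDiffAt.comp (t, q) (ht _) (contMDiffAt_fst.prodMk ih)
  rintro ⟨t, q⟩
  have h3 : Tendsto (fun k : ℕ => t / (k + 1 : ℕ)) atTop (𝓝 0) :=
    (tendsto_const_div_atTop_nhds_zero_nat t).comp (tendsto_add_atTop_nat 1)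
  obtain ⟨k, hk⟩ := (h3.eventually h1).exists
  have h4 := h2 _ (fun q => hk q (mem_univ q)) (k + 1) q
  have hk0 : ((k + 1 : ℕ) : ℝ) ≠ 0 := by positivity
  have : (fun z : ℝ × M => flow X z.1 z.2) = (fun z : ℝ × M => flow X ((k + 1 : ℕ) * z.1) z.2) ∘
      fun z : ℝ × M => (z.1 / (k + 1 : ℕ), z.2) := by
    funext z
    simp only [Function.comp_apply]
    rw [mul_div_cancel₀ _ hk0]
  rw [this]
  exact ContMDiffAt.comp (t, q) h4 ((contMDiffAt_fst.div_const _).prodMk contMDiffAt_snd)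

end Flow

end Takens

/-! ### Lie derivatives and the rank condition -/

/-- If the wedge of `dim E` functionals is nonzero, their common kernel is trivial. -/
theorem eq_zero_of_ιMulti_ne_zero {E : Type*} [NormedAddCommGroup E] [NormedSpace ℝ E]
    [FiniteDimensional ℝ E] {m : ℕ} (hm : Module.finrank ℝ E = m) (ℓ : Fin m → E →L[ℝ] ℝ)
    (hℓ : exteriorPower.ιMulti ℝ m ℓ ≠ 0) {w : E} (hw : ∀ i, ℓ i w = 0) : w = 0 := by
  have hli : LinearIndependent ℝ ℓ := by
    by_contra h
    exact hℓ ((exteriorPower.ιMulti ℝ m).map_linearDependent ℓ h)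
  have hfin : Module.finrank ℝ (E →L[ℝ] ℝ) = m := by
    rw [← hm, ← Subspace.dual_finrank_eq (K := ℝ) (V := E)]
    exact (LinearMap.toContinuousLinearMap (𝕜 := ℝ) (E := E) (F' := ℝ)).finrank_eq.symm
  have hspan := hli.span_eq_top_of_card_eq_finrank' (by rw [hfin, Fintype.card_fin])
  by_contra hw0
  obtain ⟨f, hf⟩ := SeparatingDual.exists_ne_zero (R := ℝ) hw0
  have hle : Submodule.span ℝ (range ℓ) ≤
      LinearMap.ker (ContinuousLinearMap.apply ℝ ℝ w).toLinearMap := by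
    rw [Submodule.span_le]
    rintro _ ⟨i, rfl⟩
    exact hw i
  rw [hspan] at hle
  exact hf (hle (Submodule.mem_top : f ∈ ⊤))

/-- Where `c` is not differentiable, `deriv` is `0` and the claim is trivial; thus regularity of the
iterated Lie derivatives never has to be proved. -/
theorem deriv_clm_apply_eq_zero {E : Type*} [NormedAddCommGroup E] [NormedSpace ℝ E]
    {c : ℝ → E →L[ℝ] ℝ} {w : E} (h : ∀ t, c t w = 0) (t : ℝ) : deriv c t w = 0 := by
  by_cases hd : DifferentiableAt ℝ c t
  · have h1 := hd.hasDerivAt.clm_apply (hasDerivAt_const t w)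
    simp only [h, map_zero, add_zero] at h1
    exact h1.unique (hasDerivAt_const t 0)
  · rw [deriv_zero_of_not_differentiableAt hd]; rfl

namespace Takens

section Lie

variable {m : ℕ} {M : Type*} [TopologicalSpace M] [T2Space M] [CompactSpace M]
  [ChartedSpace (EuclideanSpace ℝ (Fin m)) M] [IsManifold (𝓡 m) ∞ M]
  {X : (p : M) → TangentSpace (𝓡 m) p}

theorem mdifferentiable_flow
    (hX : ContMDiff (𝓡 m) (𝓡 m).tangent ∞ (fun p => (⟨p, X p⟩ : TangentBundle (𝓡 m) M))) (t : ℝ) :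
    MDifferentiable (𝓡 m) (𝓡 m) (flow X t) :=
  ((contMDiff_flow hX).comp (contMDiff_const.prodMk contMDiff_id : ContMDiff (𝓡 m)
    (𝓘(ℝ, ℝ).prod (𝓡 m)) ∞ (fun p : M => (t, p)))).mdifferentiable (by simp)

theorem mfderiv_flow_add
    (hX : ContMDiff (𝓡 m) (𝓡 m).tangent ∞ (fun p => (⟨p, X p⟩ : TangentBundle (𝓡 m) M)))
    (s t : ℝ) (p : M) : mfderiv (𝓡 m) (𝓡 m) (flow X (s + t)) p =
      (mfderiv (𝓡 m) (𝓡 m) (flow X s) (flow X t p)).comp (mfderiv (𝓡 m) (𝓡 m) (flow X t) p) := by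
  have : flow X (s + t) = flow X s ∘ flow X t := funext fun q => flow_add hX s t q
  rw [this]
  exact mfderiv_comp p (mdifferentiable_flow hX s _) (mdifferentiable_flow hX t p)

theorem mfderiv_flow_injective
    (hX : ContMDiff (𝓡 m) (𝓡 m).tangent ∞ (fun p => (⟨p, X p⟩ : TangentBundle (𝓡 m) M)))
    (t : ℝ) (p : M) : Function.Injective (mfderiv (𝓡 m) (𝓡 m) (flow X t) p) := by
  have h1 := mfderiv_flow_add hX (-t) t p
  have h2 : flow X (-t + t) = (id : M → M) := by
    funext q; rw [neg_add_cancel, flow_zero hX]; rfl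
  rw [h2, mfderiv_id] at h1
  intro v w hvw
  have h3 : ∀ u, mfderiv (𝓡 m) (𝓡 m) (flow X (-t)) (flow X t p)
      (mfderiv (𝓡 m) (𝓡 m) (flow X t) p u) = u := fun u => (DFunLike.congr_fun h1 u).symm
  exact (h3 v).symm.trans ((congrArg _ hvw).trans (h3 w))

/-- By the group law, pulling `L_X^j dG` back by `ψ_t` to `ψ_s(p)` and evaluating on `dψ_s(v)` is
evaluating at `ψ_{t+s}(p)` on `dψ_{t+s}(v)`. This vanishes for all `t` by induction, hence so does
its derivative. -/
theorem iterLieDeriv_flow_apply_eq_zero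
    (hX : ContMDiff (𝓡 m) (𝓡 m).tangent ∞ (fun p => (⟨p, X p⟩ : TangentBundle (𝓡 m) M)))
    {G : M → ℝ} (hG : MDifferentiable (𝓡 m) 𝓘(ℝ, ℝ) G) {p : M} {v : TangentSpace (𝓡 m) p}
    (hv : ∀ t, mvfderiv (𝓡 m) (G ∘ flow X t) p v = 0) (j : ℕ) :
    ∀ s, iterLieDeriv X G j (flow X s p) (mfderiv (𝓡 m) (𝓡 m) (flow X s) p v) = 0 := by
  induction j with
  | zero =>
    intro s
    rw [← hv s, mvfderiv_comp_apply p (hG _) (mdifferentiable_flow hX s p)]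
    rfl
  | succ j ih =>
    intro s
    have h1 : iterLieDeriv X G (j + 1) = lieDeriv X (iterLieDeriv X G j) :=
      Function.iterate_succ_apply' _ _ _
    rw [h1]
    -- Equal base points still have distinct cotangent types; evaluation is transported along the
    -- equality.
    have h2 : ∀ (q : M) (w : EuclideanSpace ℝ (Fin m)) (t : ℝ), flow X (t + s) p = q →
        iterLieDeriv X G j q w = iterLieDeriv X G j (flow X (t + s) p) w := by
      rintro q w t rfl
      rfl
    refine deriv_clm_apply_eq_zero (E := EuclideanSpace ℝ (Fin m)) (fun t => ?_) 0
    exact (h2 _ _ t (flow_add hX t s p)).trans ((congrArg (iterLieDeriv X G j (flow X (t + s) p))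
      (DFunLike.congr_fun (mfderiv_flow_add hX t s p) v).symm).trans (ih (t + s)))

/-- Under the rank condition, the differentials of `G ∘ ψ_t`, `t ∈ ℝ`, at a point have trivial
common kernel. -/
theorem exists_mvfderiv_comp_flow_ne_zero
    (hX : ContMDiff (𝓡 m) (𝓡 m).tangent ∞ (fun p => (⟨p, X p⟩ : TangentBundle (𝓡 m) M)))
    {G : M → ℝ} (hG : MDifferentiable (𝓡 m) 𝓘(ℝ, ℝ) G) {p : M}
    (hrank : ∃ J : Fin m → ℕ, ∃ s : ℝ, wedgeLieDeriv X G J (flow X s p) ≠ 0)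
    {v : TangentSpace (𝓡 m) p} (hv : v ≠ 0) :
    ∃ t, mvfderiv (𝓡 m) (G ∘ flow X t) p v ≠ 0 := by
  by_contra! h
  obtain ⟨J, s, hJ⟩ := hrank
  have h1 := eq_zero_of_ιMulti_ne_zero (E := EuclideanSpace ℝ (Fin m)) (by simp) _ hJ
    (w := mfderiv (𝓡 m) (𝓡 m) (flow X s) p v)
    fun i => iterLieDeriv_flow_apply_eq_zero hX hG h (J i) s
  exact hv (mfderiv_flow_injective hX s p (h1.trans (map_zero _).symm))

end Lie

end Takens

/-! ### Injective differential implies immersion -/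

section Immersion

/-- An injective linear map extends to an equivalence on the product with any space of the right
dimension. -/
theorem ContinuousLinearMap.exists_equiv_prod_of_injective {E F E' : Type*}
    [NormedAddCommGroup E] [NormedSpace ℝ E] [NormedAddCommGroup F] [NormedSpace ℝ F]
    [NormedAddCommGroup E'] [NormedSpace ℝ E'] [FiniteDimensional ℝ E] [FiniteDimensional ℝ F]
    [FiniteDimensional ℝ E']
    (hdim : Module.finrank ℝ F = Module.finrank ℝ E' - Module.finrank ℝ E)
    (A : E →L[ℝ] E') (hA : Function.Injective A) :
    ∃ L : (E × F) ≃L[ℝ] E', ∀ v, L (v, 0) = A v := by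
  obtain ⟨W, hW⟩ := Submodule.exists_isCompl (LinearMap.range A.toLinearMap)
  have h1 : Module.finrank ℝ (LinearMap.range A.toLinearMap) = Module.finrank ℝ E :=
    LinearMap.finrank_range_of_inj hA
  have h2 := Submodule.finrank_add_eq_of_isCompl hW
  have e : F ≃ₗ[ℝ] W := LinearEquiv.ofFinrankEq F W (by omega)
  let T : (E × F) →ₗ[ℝ] E' := A.toLinearMap.coprod (W.subtype ∘ₗ e.toLinearMap)
  have hT : Function.Injective T := by
    rw [← LinearMap.ker_eq_bot, LinearMap.ker_eq_bot']
    rintro ⟨v, w⟩ hvw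
    have h3 : A v + (e w : E') = 0 := hvw
    have h4 : A v ∈ W := by
      rw [eq_neg_of_add_eq_zero_left h3]
      exact W.neg_mem (e w).2
    have h5 : A v = 0 := by
      have := Submodule.mem_inf.2 ⟨(LinearMap.mem_range_self A.toLinearMap v), h4⟩
      rwa [hW.inf_eq_bot, Submodule.mem_bot] at this
    rw [h5, zero_add] at h3
    have h6 : e w = 0 := Subtype.ext h3
    rw [Prod.mk_eq_zero]
    exact ⟨hA (h5.trans (map_zero A).symm), by simpa using h6⟩
  have h7 : Module.finrank ℝ (E × F) = Module.finrank ℝ E' := by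
    rw [Module.finrank_prod]; omega
  refine ⟨(LinearEquiv.ofInjectiveOfFinrankEq T hT h7).toContinuousLinearEquiv, fun v => ?_⟩
  change T (v, 0) = A v
  simp [T]

/-- The local normal form of an immersion between finite-dimensional spaces. -/
theorem exists_straightening {E F E' : Type*}
    [NormedAddCommGroup E] [NormedSpace ℝ E] [NormedAddCommGroup F] [NormedSpace ℝ F]
    [NormedAddCommGroup E'] [NormedSpace ℝ E'] [CompleteSpace E] [CompleteSpace F]
    {g : E → E'} {U : Set E} (hU : IsOpen U) (hg : ContDiffOn ℝ ∞ g U) {x₀ : E} (hx₀ : x₀ ∈ U)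
    (L : (E × F) ≃L[ℝ] E') (hL : ∀ v, L (v, 0) = fderiv ℝ g x₀ v) :
    ∃ (ψ : OpenPartialHomeomorph E' E') (V : Set E), IsOpen V ∧ x₀ ∈ V ∧ V ⊆ U ∧
      MapsTo g V ψ.source ∧ ContDiffOn ℝ ∞ ψ ψ.source ∧ ContDiffOn ℝ ∞ ψ.symm ψ.target ∧
      ∀ x ∈ V, ψ (g x) = L (x, 0) := by
  -- Thickening `g` by a complement gives a map with invertible derivative `L` at `(x₀, 0)`. The
  -- chart sought is `L ∘ Θ⁻¹`, which sends `g x = Θ(x, 0)` to `L(x, 0)`.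
  let Θ : E × F → E' := fun y => g y.1 + L (0, y.2)
  have hΘ0 : ∀ x, Θ (x, 0) = g x := fun x => by
    change g x + L 0 = g x
    rw [map_zero, add_zero]
  have hUo : IsOpen (U ×ˢ (univ : Set F)) := hU.prod isOpen_univ
  have hΘ : ContDiffOn ℝ ∞ Θ (U ×ˢ (univ : Set F)) := by
    refine (hg.comp contDiff_fst.contDiffOn fun y hy => hy.1).add (ContDiff.contDiffOn ?_)
    exact L.contDiff.comp (contDiff_const.prodMk contDiff_snd)
  have hmem : (x₀, (0 : F)) ∈ U ×ˢ (univ : Set F) := ⟨hx₀, mem_univ _⟩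
  have hΘat : ContDiffAt ℝ ∞ Θ (x₀, 0) := hΘ.contDiffAt (hUo.mem_nhds hmem)
  have hder : HasFDerivAt Θ (L : (E × F) →L[ℝ] E') (x₀, 0) := by
    have h1 : HasFDerivAt g (fderiv ℝ g x₀) x₀ :=
      ((hg.contDiffAt (hU.mem_nhds hx₀)).differentiableAt (by simp)).hasFDerivAt
    have h2 : HasFDerivAt (fun y : E × F => g y.1)
        ((fderiv ℝ g x₀).comp (.fst ℝ E F)) (x₀, 0) :=
      HasFDerivAt.comp (x₀, (0 : F)) h1 hasFDerivAt_fst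
    have h3 : HasFDerivAt (fun y : E × F => L (0, y.2))
        ((L : (E × F) →L[ℝ] E').comp ((ContinuousLinearMap.inr ℝ E F).comp (.snd ℝ E F)))
        (x₀, 0) := ContinuousLinearMap.hasFDerivAt
          ((L : (E × F) →L[ℝ] E').comp ((ContinuousLinearMap.inr ℝ E F).comp (.snd ℝ E F)))
    refine (h2.add h3).congr_fderiv ?_
    ext v
    · simp [← hL]
    · simp
  let Θh := hΘat.toOpenPartialHomeomorph Θ hder (by simp)
  -- Restricting to points with invertible `DΘ` makes the inverse smooth on its whole domain, as a
  -- chart requires.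
  let S : Set (E × F) := U ×ˢ (univ : Set F) ∩ fderiv ℝ Θ ⁻¹' range ((↑) : ((E × F) ≃L[ℝ] E') → _)
  have hS : IsOpen S := (hΘ.continuousOn_fderiv_of_isOpen hUo (by simp)).isOpen_inter_preimage hUo
    ContinuousLinearEquiv.isOpen
  let Θr := Θh.restrOpen S hS
  have hsrc : Θr.source = Θh.source ∩ S := rfl
  have hΘr : ⇑Θr = Θ := rfl
  let ψ := Θr.symm.transHomeomorph L.toHomeomorph
  have h0 : (x₀, (0 : F)) ∈ Θr.source :=
    ⟨hΘat.mem_toOpenPartialHomeomorph_source hder (by simp), hmem, L, hder.fderiv.symm⟩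
  refine ⟨ψ, (fun x => (x, (0 : F))) ⁻¹' Θr.source, Θr.open_source.preimage (by fun_prop), h0,
    fun x hx => hx.2.1.1, fun x hx => ?_, fun y hy => ?_, fun y hy => ?_, fun x hx => ?_⟩
  · have := Θr.map_source hx
    rw [hΘr, hΘ0] at this
    exact this
  · have hy' : Θr.symm y ∈ Θr.source := Θr.map_target hy
    obtain ⟨L', hL'⟩ := hy'.2.2
    have h1 : ContDiffAt ℝ ∞ Θr (Θr.symm y) := hΘ.contDiffAt (hUo.mem_nhds hy'.2.1)
    have h2 : HasFDerivAt Θr (L' : (E × F) →L[ℝ] E') (Θr.symm y) := by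
      rw [hL']
      exact (h1.differentiableAt (by simp)).hasFDerivAt
    exact (L.contDiff.contDiffAt.comp y (Θr.contDiffAt_symm hy h2 h1)).contDiffWithinAt
  · have hy' : L.symm y ∈ Θr.source := hy
    have h1 : ContDiffAt ℝ ∞ Θ (L.symm y) := hΘ.contDiffAt (hUo.mem_nhds hy'.2.1)
    exact (h1.comp y L.symm.contDiff.contDiffAt).contDiffWithinAt
  · have h1 : Θr.symm (Θr (x, 0)) = (x, 0) := Θr.left_inv hx
    rw [hΘr, hΘ0] at h1
    change L (Θr.symm (g x)) = _
    rw [h1]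

theorem isImmersion_of_injective_mfderiv {E E' : Type*}
    [NormedAddCommGroup E] [NormedSpace ℝ E]
    [NormedAddCommGroup E'] [NormedSpace ℝ E'] [FiniteDimensional ℝ E] [FiniteDimensional ℝ E']
    {M : Type*} [TopologicalSpace M] [ChartedSpace E M] [IsManifold 𝓘(ℝ, E) ∞ M] {f : M → E'}
    (hf : ContMDiff 𝓘(ℝ, E) 𝓘(ℝ, E') ∞ f)
    (hinj : ∀ p, Function.Injective (mfderiv 𝓘(ℝ, E) 𝓘(ℝ, E') f p)) :
    Manifold.IsImmersion 𝓘(ℝ, E) 𝓘(ℝ, E') ∞ f := by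
  have := FiniteDimensional.complete ℝ E
  refine Manifold.IsImmersionOfComplement.isImmersion
    (F := EuclideanSpace ℝ (Fin (Module.finrank ℝ E' - Module.finrank ℝ E))) fun p => ?_
  let φ := chartAt E p
  let g : E → E' := f ∘ φ.symm
  have hg : ContDiffOn ℝ ∞ g φ.target := by
    rw [← contMDiffOn_iff_contDiffOn]
    exact hf.comp_contMDiffOn contMDiffOn_chart_symm
  have hp : φ p ∈ φ.target := mem_chart_target E p
  have hmf : mfderiv 𝓘(ℝ, E) 𝓘(ℝ, E') f p = fderiv ℝ g (φ p) := by
    rw [(hf.mdifferentiable (by simp) p).mfderiv]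
    simp only [g, φ, writtenInExtChartAt, mfld_simps, fderivWithin_univ]
    rfl
  have hinj' : Function.Injective (fderiv ℝ g (φ p)) := hmf ▸ hinj p
  obtain ⟨L, hL⟩ := ContinuousLinearMap.exists_equiv_prod_of_injective
    (F := EuclideanSpace ℝ (Fin (Module.finrank ℝ E' - Module.finrank ℝ E))) (by simp)
    (fderiv ℝ g (φ p)) hinj'
  obtain ⟨ψ, V, hV, hpV, hVU, hmaps, hψ, hψs, heq⟩ :=
    exists_straightening φ.open_target hg hp L hL
  have hs : IsOpen (φ.source ∩ φ ⁻¹' V) := φ.isOpen_inter_preimage hV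
  refine Manifold.IsImmersionAtOfComplement.mk_of_charts L (φ.restr (φ.source ∩ φ ⁻¹' V)) ψ
    ?_ ?_ ?_ ?_ ?_ ?_
  · rw [φ.restr_source' _ hs]
    exact ⟨mem_chart_source E p, mem_chart_source E p, hpV⟩
  · have := hmaps hpV
    rwa [show g (φ p) = f p from congrArg f (φ.left_inv (mem_chart_source E p))] at this
  · exact restr_mem_maximalAtlas _ (IsManifold.chart_mem_maximalAtlas p) hs
  · exact ψ.mem_maximalAtlas_of_contMDiffOn hψ.contMDiffOn hψs.contMDiffOn
  · rw [φ.restr_source' _ hs]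
    rintro q ⟨-, hq, hqV⟩
    have := hmaps hqV
    rwa [show g (φ q) = f q from congrArg f (φ.left_inv hq)] at this
  · intro x hx
    have hx' : x ∈ (φ.restr (φ.source ∩ φ ⁻¹' V)).target := by simpa using hx
    have h1 := (φ.restr (φ.source ∩ φ ⁻¹' V)).map_target hx'
    rw [φ.restr_source' _ hs] at h1
    have h2 : x ∈ V := by
      have h3 := h1.2.2
      rwa [mem_preimage, show φ ((φ.restr (φ.source ∩ φ ⁻¹' V)).symm x) = x from
        (φ.restr (φ.source ∩ φ ⁻¹' V)).right_inv hx'] at h3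
    simpa [g] using heq x h2

end Immersion

/-! ### Separation by finitely many times, locally -/

section Sampling

theorem IsCompact.eventually_forall_mem_of_forall_prod {α β : Type*} [TopologicalSpace α]
    {K : Set α} (hK : IsCompact K) {l : Filter β} {P : α → β → Prop}
    (hP : ∀ a ∈ K, ∀ᶠ z in 𝓝 a ×ˢ l, P z.1 z.2) : ∀ᶠ b in l, ∀ a ∈ K, P a b := by
  have h1 : ∀ᶠ z in 𝓝ˢ K ×ˢ l, P z.1 z.2 := hK.mem_nhdsSet_prod_of_forall hP
  obtain ⟨pa, hpa, pb, hpb, h⟩ := eventually_prod_iff.1 h1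
  filter_upwards [hpb] with b hb a ha
  exact h (subset_of_mem_nhdsSet hpa ha) hb

variable {E : Type*} [NormedAddCommGroup E] [NormedSpace ℝ E]

/-- Both points are taken at the same time, so their difference is `r • (0, v)` and strict
differentiability compares the increment with `r A(0, v)`. Here `|A(0, v)| > c/2`, while the error
is at most `|r| c/4`. -/
theorem ContDiffAt.eventually_sample_ne {F : ℝ × E → ℝ} {t : ℝ} {x₀ v₀ : E}
    (hF : ContDiffAt ℝ 1 F (t, x₀)) (hv : fderiv ℝ F (t, x₀) (0, v₀) ≠ 0) {s : ℕ → ℝ}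
    (hs : Tendsto s atTop (𝓝 t)) :
    ∀ᶠ z : E × ℕ × E × E in 𝓝 v₀ ×ˢ (atTop ×ˢ (𝓝 x₀ ×ˢ 𝓝 x₀)), ∀ r : ℝ, r ≠ 0 →
      z.2.2.2 - z.2.2.1 = r • z.1 → F (s z.2.1, z.2.2.1) ≠ F (s z.2.1, z.2.2.2) := by
  set A := fderiv ℝ F (t, x₀)
  have hA : HasStrictFDerivAt F A (t, x₀) := hF.hasStrictFDerivAt (by simp)
  set c := |A (0, v₀)|
  have hc : 0 < c := abs_pos.2 hv
  have h1 := hA.isLittleO.def (c := c / (4 * (‖v₀‖ + 1))) (by positivity)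
  have hlim : Tendsto (fun z : E × ℕ × E × E => ((s z.2.1, z.2.2.1), (s z.2.1, z.2.2.2)))
      (𝓝 v₀ ×ˢ (atTop ×ˢ (𝓝 x₀ ×ˢ 𝓝 x₀))) (𝓝 ((t, x₀), (t, x₀))) := by
    have hn : Tendsto (fun z : E × ℕ × E × E => s z.2.1)
        (𝓝 v₀ ×ˢ (atTop ×ˢ (𝓝 x₀ ×ˢ 𝓝 x₀))) (𝓝 t) := hs.comp (tendsto_fst.comp tendsto_snd)
    exact (hn.prodMk_nhds (tendsto_fst.comp (tendsto_snd.comp tendsto_snd))).prodMk_nhds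
      (hn.prodMk_nhds (tendsto_snd.comp (tendsto_snd.comp tendsto_snd)))
  have h2 : ∀ᶠ v in 𝓝 v₀, c / 2 < |A (0, v)| := by
    have : ContinuousAt (fun v => |A (0, v)|) v₀ := by fun_prop
    exact this.eventually (lt_mem_nhds (half_lt_self hc))
  have h3 : ∀ᶠ v in 𝓝 v₀, ‖v‖ < ‖v₀‖ + 1 :=
    continuousAt_id.norm.eventually (gt_mem_nhds (lt_add_one _))
  filter_upwards [hlim.eventually h1, tendsto_fst.eventually h2, tendsto_fst.eventually h3]
    with z hz1 hz2 hz3 r hr hxy heq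
  have h4 : ((s z.2.1, z.2.2.1) : ℝ × E) - (s z.2.1, z.2.2.2) = (-r) • ((0 : ℝ), z.1) := by
    rw [Prod.mk_sub_mk, sub_self, Prod.smul_mk, smul_zero, neg_smul, ← hxy, neg_sub]
  rw [heq, sub_self, zero_sub, h4, map_smul, norm_neg, norm_smul, norm_smul, norm_neg,
    mul_left_comm] at hz1
  have h5 := le_of_mul_le_mul_left hz1 (norm_pos_iff.2 hr)
  have h6 : ‖((0 : ℝ), z.1)‖ ≤ ‖v₀‖ + 1 := by
    rw [Prod.norm_mk, norm_zero, max_eq_right (norm_nonneg _)]; exact hz3.le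
  have h7 : c / (4 * (‖v₀‖ + 1)) * ‖((0 : ℝ), z.1)‖ ≤ c / 4 := by
    calc _ ≤ c / (4 * (‖v₀‖ + 1)) * (‖v₀‖ + 1) := by gcongr
      _ = c / 4 := by field_simp
  rw [Real.norm_eq_abs] at h5
  linarith

theorem ContDiffAt.eventually_sample_fderiv_ne {F : ℝ × E → ℝ} {t : ℝ} {x₀ v₀ : E}
    (hF : ContDiffAt ℝ 1 F (t, x₀)) (hv : fderiv ℝ F (t, x₀) (0, v₀) ≠ 0) {s : ℕ → ℝ}
    (hs : Tendsto s atTop (𝓝 t)) :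
    ∀ᶠ z : E × ℕ × E in 𝓝 v₀ ×ˢ (atTop ×ˢ 𝓝 x₀), fderiv ℝ F (s z.2.1, z.2.2) (0, z.1) ≠ 0 := by
  have hlim : Tendsto (fun z : E × ℕ × E => ((s z.2.1, z.2.2), z.1))
      (𝓝 v₀ ×ˢ (atTop ×ˢ 𝓝 x₀)) (𝓝 ((t, x₀), v₀)) :=
    ((hs.comp (tendsto_fst.comp tendsto_snd)).prodMk_nhds
      (tendsto_snd.comp tendsto_snd)).prodMk_nhds tendsto_fst
  have hcont : ContinuousAt (fun w : (ℝ × E) × E => fderiv ℝ F w.1 (0, w.2)) ((t, x₀), v₀) := by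
    have h1 : ContinuousAt (fun w : (ℝ × E) × E => fderiv ℝ F w.1) ((t, x₀), v₀) :=
      ContinuousAt.comp (f := Prod.fst) (hF.continuousAt_fderiv (by simp)) continuousAt_fst
    exact h1.clm_apply (by fun_prop)
  exact hlim.eventually (hcont.eventually_ne hv)

/-- If the differentials of a family `F (t, ·)` separate tangent vectors at `x₀`, then for all
large `n` the times in `S n` already separate points and tangent vectors near `x₀`. -/
theorem eventually_sample_separates [FiniteDimensional ℝ E] {F : ℝ × E → ℝ} {x₀ : E}
    (hF : ∀ t, ContDiffAt ℝ 1 F (t, x₀)) (hv : ∀ v ≠ 0, ∃ t, fderiv ℝ F (t, x₀) (0, v) ≠ 0)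
    {S : ℕ → Set ℝ} (hS : ∀ t, ∃ s : ℕ → ℝ, (∀ᶠ n in atTop, s n ∈ S n) ∧ Tendsto s atTop (𝓝 t)) :
    (∀ᶠ z : ℕ × E × E in atTop ×ˢ (𝓝 x₀ ×ˢ 𝓝 x₀), z.2.1 ≠ z.2.2 →
      ∃ t ∈ S z.1, F (t, z.2.1) ≠ F (t, z.2.2)) ∧
    ∀ᶠ z : ℕ × E in atTop ×ˢ 𝓝 x₀, ∀ v ≠ 0, ∃ t ∈ S z.1, fderiv ℝ F (t, z.2) (0, v) ≠ 0 := by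
  have hK : IsCompact (Metric.sphere (0 : E) 1) := isCompact_sphere 0 1
  have hne : ∀ v ∈ Metric.sphere (0 : E) 1, v ≠ 0 := fun v hv => ne_zero_of_mem_unit_sphere ⟨v, hv⟩
  constructor
  · have h1 : ∀ᶠ z : ℕ × E × E in atTop ×ˢ (𝓝 x₀ ×ˢ 𝓝 x₀), ∀ v ∈ Metric.sphere (0 : E) 1,
        ∀ r : ℝ, r ≠ 0 → z.2.2 - z.2.1 = r • v → ∃ t ∈ S z.1, F (t, z.2.1) ≠ F (t, z.2.2) := by
      refine hK.eventually_forall_mem_of_forall_prod fun v hvs => ?_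
      obtain ⟨t, ht⟩ := hv v (hne v hvs)
      obtain ⟨s, hsS, hs⟩ := hS t
      filter_upwards [(hF t).eventually_sample_ne ht hs,
        (tendsto_fst.comp tendsto_snd).eventually hsS] with z hz hz' r hr hxy
      exact ⟨_, hz', hz r hr hxy⟩
    filter_upwards [h1] with z hz hxy
    have h2 : ‖z.2.2 - z.2.1‖ ≠ 0 := norm_ne_zero_iff.2 (sub_ne_zero.2 hxy.symm)
    refine hz (‖z.2.2 - z.2.1‖⁻¹ • (z.2.2 - z.2.1)) ?_ _ h2 ?_
    · rw [mem_sphere_zero_iff_norm, norm_smul, norm_inv, norm_norm, inv_mul_cancel₀ h2]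
    · rw [smul_smul, mul_inv_cancel₀ h2, one_smul]
  · have h1 : ∀ᶠ z : ℕ × E in atTop ×ˢ 𝓝 x₀, ∀ v ∈ Metric.sphere (0 : E) 1,
        ∃ t ∈ S z.1, fderiv ℝ F (t, z.2) (0, v) ≠ 0 := by
      refine hK.eventually_forall_mem_of_forall_prod fun v hvs => ?_
      obtain ⟨t, ht⟩ := hv v (hne v hvs)
      obtain ⟨s, hsS, hs⟩ := hS t
      filter_upwards [(hF t).eventually_sample_fderiv_ne ht hs,
        (tendsto_fst.comp tendsto_snd).eventually hsS] with z hz hz'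
      exact ⟨_, hz', hz⟩
    filter_upwards [h1] with z hz v hv0
    have h2 : ‖v‖ ≠ 0 := norm_ne_zero_iff.2 hv0
    obtain ⟨t, ht, h3⟩ := hz (‖v‖⁻¹ • v)
      (by rw [mem_sphere_zero_iff_norm, norm_smul, norm_inv, norm_norm, inv_mul_cancel₀ h2])
    refine ⟨t, ht, fun h4 => h3 ?_⟩
    rw [show ((0 : ℝ), ‖v‖⁻¹ • v) = ‖v‖⁻¹ • ((0 : ℝ), v) by rw [Prod.smul_mk, smul_zero],
      map_smul, h4, smul_zero]

end Sampling

/-! ### Separation by finitely many times, globally -/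

section SamplingManifold

variable {E : Type*} [NormedAddCommGroup E] [NormedSpace ℝ E] [FiniteDimensional ℝ E]
  {M : Type*} [TopologicalSpace M] [ChartedSpace E M] [IsManifold 𝓘(ℝ, E) ∞ M]

/-- A smooth family of functions on a compact manifold which separates points and tangent vectors
does so already for finitely many, sufficiently dense, parameters. -/
theorem eventually_forall_sample_separates [CompactSpace M] {h : ℝ × M → ℝ}
    (hh : ContMDiff (𝓘(ℝ, ℝ).prod 𝓘(ℝ, E)) 𝓘(ℝ, ℝ) ∞ h)
    (hv : ∀ (p : M) (v : TangentSpace 𝓘(ℝ, E) p), v ≠ 0 →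
      ∃ t, mvfderiv 𝓘(ℝ, E) (fun q => h (t, q)) p v ≠ 0)
    (hsep : ∀ p q : M, p ≠ q → ∃ t, h (t, p) ≠ h (t, q))
    {S : ℕ → Set ℝ} (hS : ∀ t, ∃ s : ℕ → ℝ, (∀ᶠ n in atTop, s n ∈ S n) ∧ Tendsto s atTop (𝓝 t)) :
    ∀ᶠ n in atTop, (∀ p q : M, p ≠ q → ∃ t ∈ S n, h (t, p) ≠ h (t, q)) ∧
      ∀ (p : M) (v : TangentSpace 𝓘(ℝ, E) p), v ≠ 0 →
        ∃ t ∈ S n, mvfderiv 𝓘(ℝ, E) (fun q => h (t, q)) p v ≠ 0 := by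
  have hslice : ∀ t, ContMDiff 𝓘(ℝ, E) 𝓘(ℝ, ℝ) ∞ (fun q => h (t, q)) := fun t =>
    hh.comp (contMDiff_const.prodMk contMDiff_id)
  have hchart : ∀ p₀ : M, ∀ t, ∀ x ∈ (extChartAt 𝓘(ℝ, E) p₀).target,
      ContDiffAt ℝ ∞ (fun w : ℝ × E => h (w.1, (extChartAt 𝓘(ℝ, E) p₀).symm w.2)) (t, x) := by
    intro p₀ t x hx
    rw [← contMDiffAt_iff_contDiffAt]
    have h1 : ContMDiffAt 𝓘(ℝ, E) 𝓘(ℝ, E) ∞ (extChartAt 𝓘(ℝ, E) p₀).symm x :=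
      (contMDiffOn_extChartAt_symm p₀).contMDiffAt (extChartAt_target_mem_nhds' hx)
    have h2 : ContMDiffAt 𝓘(ℝ, ℝ × E) (𝓘(ℝ, ℝ).prod 𝓘(ℝ, E)) ∞
        (fun w : ℝ × E => (w.1, (extChartAt 𝓘(ℝ, E) p₀).symm w.2)) (t, x) :=
      contDiffAt_fst.contMDiffAt.prodMk
        (ContMDiffAt.comp (t, x) h1 contDiffAt_snd.contMDiffAt)
    exact ContMDiffAt.comp (t, x) hh.contMDiffAt h2
  have hpart : ∀ p₀ : M, ∀ t, ∀ p ∈ (extChartAt 𝓘(ℝ, E) p₀).source, ∀ v : TangentSpace 𝓘(ℝ, E) p,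
      mvfderiv 𝓘(ℝ, E) (fun q => h (t, q)) p v =
        fderiv ℝ (fun w : ℝ × E => h (w.1, (extChartAt 𝓘(ℝ, E) p₀).symm w.2))
          (t, extChartAt 𝓘(ℝ, E) p₀ p) (0, mfderiv 𝓘(ℝ, E) 𝓘(ℝ, E) (extChartAt 𝓘(ℝ, E) p₀) p v) := by
    intro p₀ t p hp v
    set φ := extChartAt 𝓘(ℝ, E) p₀
    have h1 : HasFDerivAt (fun x => h (t, φ.symm x))
        ((fderiv ℝ (fun w : ℝ × E => h (w.1, φ.symm w.2)) (t, φ p)).comp (.inr ℝ ℝ E)) (φ p) :=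
      HasFDerivAt.comp (φ p) (((hchart p₀ t _ (φ.map_source hp)).differentiableAt
        (by simp)).hasFDerivAt) (hasFDerivAt_prodMk_right t (φ p))
    have h2 : MDifferentiableAt 𝓘(ℝ, E) 𝓘(ℝ, E) φ p :=
      mdifferentiableAt_extChartAt (by rwa [← extChartAt_source 𝓘(ℝ, E)])
    have h3 := h1.hasMFDerivAt.comp p h2.hasMFDerivAt
    have h4 : (fun q => h (t, q)) =ᶠ[𝓝 p] (fun x => h (t, φ.symm x)) ∘ φ := by
      filter_upwards [(isOpen_extChartAt_source p₀).mem_nhds hp] with q hq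
      rw [Function.comp_apply, φ.left_inv hq]
    have h5 := (h3.congr_of_eventuallyEq h4).mfderiv
    exact DFunLike.congr_fun h5 v
  have hlocal : ∀ p₀ : M, _ := fun p₀ => eventually_sample_separates
    (x₀ := extChartAt 𝓘(ℝ, E) p₀ p₀)
    (fun t => (hchart p₀ t _ (mem_extChartAt_target p₀)).of_le (by simp))
    (fun v hv0 => by
      obtain ⟨L, hL⟩ := isInvertible_mfderiv_extChartAt (I := 𝓘(ℝ, E)) (mem_extChartAt_source p₀)
      obtain ⟨t, ht⟩ := hv p₀ (L.symm v)
        fun h0 => hv0 (L.symm.injective (h0.trans (map_zero L.symm).symm))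
      refine ⟨t, fun h0 => ht ?_⟩
      rw [hpart p₀ t p₀ (mem_extChartAt_source p₀), ← hL, ← h0]
      congr 2
      exact L.apply_symm_apply v) hS
  refine Eventually.and ?_ ?_
  · have h1 : ∀ᶠ n in atTop, ∀ z ∈ (univ : Set (M × M)), z.1 ≠ z.2 →
        ∃ t ∈ S n, h (t, z.1) ≠ h (t, z.2) := by
      refine isCompact_univ.eventually_forall_mem_of_forall_prod ?_
      rintro ⟨p₀, q₀⟩ -
      -- On the diagonal of `M × M` the infinitesimal separation is used in a chart; off it, mere
      -- continuity.
      by_cases hpq : p₀ = q₀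
      · subst hpq
        set φ := extChartAt 𝓘(ℝ, E) p₀
        have hφ : Tendsto φ (𝓝 p₀) (𝓝 (φ p₀)) := continuousAt_extChartAt p₀
        have hlim : Tendsto (fun z : (M × M) × ℕ => (z.2, φ z.1.1, φ z.1.2))
            (𝓝 (p₀, p₀) ×ˢ atTop) (atTop ×ˢ (𝓝 (φ p₀) ×ˢ 𝓝 (φ p₀))) := by
          rw [nhds_prod_eq]
          exact tendsto_snd.prodMk ((hφ.comp (tendsto_fst.comp tendsto_fst)).prodMk
            (hφ.comp (tendsto_snd.comp tendsto_fst)))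
        have hsrc := extChartAt_source_mem_nhds (I := 𝓘(ℝ, E)) p₀
        have hsrc2 : ∀ᶠ z : M × M in 𝓝 (p₀, p₀), z.1 ∈ φ.source ∧ z.2 ∈ φ.source :=
          prod_mem_nhds hsrc hsrc
        filter_upwards [hlim.eventually (hlocal p₀).1, tendsto_fst.eventually hsrc2]
          with z hz hz2 hne
        obtain ⟨t, ht, hne'⟩ := hz fun heq => hne (φ.injOn hz2.1 hz2.2 heq)
        refine ⟨t, ht, fun heq => hne' ?_⟩
        change h (t, φ.symm (φ z.1.1)) = h (t, φ.symm (φ z.1.2))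
        rw [φ.left_inv hz2.1, φ.left_inv hz2.2, heq]
      · obtain ⟨t, ht⟩ := hsep p₀ q₀ hpq
        obtain ⟨s, hsS, hs⟩ := hS t
        have hlim : ∀ {pr : M × M → M} {a : M}, Tendsto pr (𝓝 (p₀, q₀)) (𝓝 a) →
            Tendsto (fun z : (M × M) × ℕ => h (s z.2, pr z.1)) (𝓝 (p₀, q₀) ×ˢ atTop)
              (𝓝 (h (t, a))) := fun hpr =>
          (hh.continuous.tendsto _).comp ((hs.comp tendsto_snd).prodMk_nhds (hpr.comp tendsto_fst))
        have hdiff := (hlim (pr := Prod.fst) continuousAt_fst).sub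
          (hlim (pr := Prod.snd) continuousAt_snd)
        filter_upwards [hdiff.eventually_ne (sub_ne_zero.2 ht), tendsto_snd.eventually hsS]
          with z hz hz' _
        exact ⟨_, hz', sub_ne_zero.1 hz⟩
    exact h1.mono fun n hn p q => hn (p, q) (mem_univ _)
  · have h1 : ∀ᶠ n in atTop, ∀ p ∈ (univ : Set M), ∀ v : TangentSpace 𝓘(ℝ, E) p, v ≠ 0 →
        ∃ t ∈ S n, mvfderiv 𝓘(ℝ, E) (fun q => h (t, q)) p v ≠ 0 := by
      refine isCompact_univ.eventually_forall_mem_of_forall_prod fun p₀ _ => ?_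
      have hlim : Tendsto (fun z : M × ℕ => (z.2, extChartAt 𝓘(ℝ, E) p₀ z.1))
          (𝓝 p₀ ×ˢ atTop) (atTop ×ˢ 𝓝 (extChartAt 𝓘(ℝ, E) p₀ p₀)) :=
        tendsto_snd.prodMk ((continuousAt_extChartAt p₀).tendsto.comp tendsto_fst)
      have hsrc := extChartAt_source_mem_nhds (I := 𝓘(ℝ, E)) p₀
      filter_upwards [hlim.eventually (hlocal p₀).2, tendsto_fst.eventually hsrc] with z hz hz2 v hv0
      obtain ⟨L, hL⟩ := isInvertible_mfderiv_extChartAt (I := 𝓘(ℝ, E)) hz2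
      obtain ⟨t, ht, hne⟩ := hz (L v)
        fun h0 => hv0 (L.injective (h0.trans (map_zero L).symm))
      refine ⟨t, ht, ?_⟩
      rw [hpart p₀ t z.1 hz2, ← hL]
      exact hne
    exact h1.mono fun n hn p => hn p (mem_univ _)

end SamplingManifold

/-! ### The Takens map -/

namespace Takens

/-- The times `k / n - n`, `0 ≤ k ≤ 2 n²`. -/
def sampleTimes (n : ℕ) : Set ℝ := {t | ∃ k : ℕ, k ≤ 2 * n ^ 2 ∧ t = k * (1 / n : ℝ) - n}

/-- Rounding `t` down to the grid of mesh `1/n` costs at most `1/n`, and the grid covers `[-n, n]`,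
which eventually contains `t`. -/
theorem exists_tendsto_sampleTimes (t : ℝ) :
    ∃ s : ℕ → ℝ, (∀ᶠ n in atTop, s n ∈ sampleTimes n) ∧ Tendsto s atTop (𝓝 t) := by
  have hbig : ∀ᶠ n : ℕ in atTop, |t| ≤ n ∧ (0 : ℝ) < n :=
    (tendsto_natCast_atTop_atTop.eventually_ge_atTop _).and
      (tendsto_natCast_atTop_atTop.eventually_gt_atTop _)
  refine ⟨fun n => (⌊(t + n) * n⌋₊ : ℕ) * (1 / n : ℝ) - n, ?_, ?_⟩
  · filter_upwards [hbig] with n ⟨hn, hn0⟩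
    refine ⟨_, ?_, rfl⟩
    refine Nat.floor_le_of_le ?_
    push_cast
    nlinarith [le_abs_self t]
  · have h1 : Tendsto (fun n : ℕ => t - 1 / (n : ℝ)) atTop (𝓝 t) := by
      simpa using tendsto_const_nhds.sub (tendsto_const_div_atTop_nhds_zero_nat (1 : ℝ))
    refine tendsto_of_tendsto_of_tendsto_of_le_of_le' h1 tendsto_const_nhds ?_ ?_
    · filter_upwards [hbig] with n ⟨hn, hn0⟩
      have h2 := (Nat.lt_floor_add_one ((t + n) * n)).le
      have h3 : (t + n) * n * (1 / n : ℝ) = t + n := by field_simp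
      have h4 := mul_le_mul_of_nonneg_right h2 (by positivity : (0 : ℝ) ≤ 1 / n)
      rw [h3, add_mul, one_mul] at h4
      linarith
    · filter_upwards [hbig] with n ⟨hn, hn0⟩
      have h2 := Nat.floor_le (a := (t + n) * n)
        (mul_nonneg (by linarith [neg_abs_le t]) hn0.le)
      have h3 : (t + n) * n * (1 / n : ℝ) = t + n := by field_simp
      have h4 := mul_le_mul_of_nonneg_right h2 (by positivity : (0 : ℝ) ≤ 1 / n)
      rw [h3] at h4
      linarith

variable {m : ℕ} {M : Type*} [TopologicalSpace M] [T2Space M] [CompactSpace M]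
  [ChartedSpace (EuclideanSpace ℝ (Fin m)) M] [IsManifold (𝓡 m) ∞ M]
  {X : (p : M) → TangentSpace (𝓡 m) p}

theorem contMDiff_takensMap
    (hX : ContMDiff (𝓡 m) (𝓡 m).tangent ∞ (fun p => (⟨p, X p⟩ : TangentBundle (𝓡 m) M)))
    {G : M → ℝ} (hG : ContMDiff (𝓡 m) 𝓘(ℝ, ℝ) ∞ G) (τ : ℝ) (N : ℕ) :
    ContMDiff (𝓡 m) (𝓡 (N + 1)) ∞ (takensMap X G τ N) := by
  have h1 : ContMDiff (𝓡 m) 𝓘(ℝ, Fin (N + 1) → ℝ) ∞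
      (fun p => fun k : Fin (N + 1) => observationCurve X G p ((k : ℕ) * τ)) :=
    contMDiff_pi_space.2 fun k => hG.comp ((contMDiff_flow hX).comp
      (contMDiff_const.prodMk contMDiff_id))
  exact (PiLp.continuousLinearEquiv 2 ℝ (fun _ : Fin (N + 1) => ℝ)).symm.contDiff.contMDiff.comp h1

theorem mvfderiv_observation_eq_zero
    (hX : ContMDiff (𝓡 m) (𝓡 m).tangent ∞ (fun p => (⟨p, X p⟩ : TangentBundle (𝓡 m) M)))
    {G : M → ℝ} (hG : ContMDiff (𝓡 m) 𝓘(ℝ, ℝ) ∞ G) {τ : ℝ} {N : ℕ} {p : M}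
    {v : TangentSpace (𝓡 m) p}
    (hv : mfderiv (𝓡 m) (𝓡 (N + 1)) (takensMap X G τ N) p v = 0) {k : ℕ} (hk : k ≤ N) :
    mvfderiv (𝓡 m) (G ∘ flow X (k * τ)) p v = 0 := by
  let π : EuclideanSpace ℝ (Fin (N + 1)) →L[ℝ] ℝ :=
    EuclideanSpace.proj (⟨k, Nat.lt_succ_of_le hk⟩ : Fin (N + 1))
  have h1 : G ∘ flow X (k * τ) = π ∘ takensMap X G τ N := rfl
  rw [h1, mvfderiv_comp_apply p π.differentiableAt.mdifferentiableAt
    ((contMDiff_takensMap hX hG τ N).mdifferentiable (by simp) p), hv]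
  exact map_zero _

end Takens

theorem theorem1 (m : ℕ) {M : Type*} [TopologicalSpace M] [T2Space M] [CompactSpace M]
    [ChartedSpace (EuclideanSpace ℝ (Fin m)) M] [IsManifold (𝓡 m) ∞ M]
    (X : (p : M) → TangentSpace (𝓡 m) p)
    (hX : ContMDiff (𝓡 m) (𝓡 m).tangent ∞ (fun p => (⟨p, X p⟩ : TangentBundle (𝓡 m) M)))
    (G : M → ℝ) (hG : ContMDiff (𝓡 m) 𝓘(ℝ, ℝ) ∞ G)
    (hrank : ∀ p : M, ∃ J : Fin m → ℕ, ∃ s : ℝ,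
      Takens.wedgeLieDeriv X G J (Takens.flow X s p) ≠ 0)
    (hdist : ∀ p q : M, p ≠ q →
      Takens.observationCurve X G p ≠ Takens.observationCurve X G q) :
    ∃ N : ℕ, 0 < N ∧ ∃ τ : ℝ, 0 < τ ∧
      Manifold.IsSmoothEmbedding (𝓡 m) (𝓡 (N + 1)) ∞ (Takens.takensMap X G τ N) := by
  have hGd : MDifferentiable (𝓡 m) 𝓘(ℝ, ℝ) G := hG.mdifferentiable (by simp)
  have hh : ContMDiff (𝓘(ℝ, ℝ).prod (𝓡 m)) 𝓘(ℝ, ℝ) ∞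
      (fun z : ℝ × M => G (Takens.flow X z.1 z.2)) := hG.comp (Takens.contMDiff_flow hX)
  have hev := eventually_forall_sample_separates hh
    (fun p v hv => Takens.exists_mvfderiv_comp_flow_ne_zero hX hGd (hrank p) hv)
    (fun p q hpq => Function.ne_iff.1 (hdist p q hpq)) Takens.exists_tendsto_sampleTimes
  obtain ⟨n, ⟨hinj, himm⟩, hn⟩ := (hev.and (eventually_gt_atTop 0)).exists
  have hn0 : (0 : ℝ) < n := Nat.cast_pos.2 hn
  refine ⟨2 * n ^ 2, by positivity, 1 / n, by positivity, ?_, ?_⟩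
  · refine isImmersion_of_injective_mfderiv (Takens.contMDiff_takensMap hX hG _ _) fun p => ?_
    refine (injective_iff_map_eq_zero _).2 fun v hv => ?_
    by_contra hv0
    -- Separation is applied at `ψ_n(p)`: time `k/n - n` there is time `k/n` at `p`, one of the
    -- nonnegative times the Takens map records.
    have hw0 : mfderiv (𝓡 m) (𝓡 m) (Takens.flow X n) p v ≠ 0 := fun h0 =>
      hv0 (Takens.mfderiv_flow_injective hX n p (h0.trans (map_zero _).symm))
    obtain ⟨t, ⟨k, hk, rfl⟩, ht⟩ := himm (Takens.flow X n p) _ hw0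
    refine ht ?_
    rw [← Takens.mvfderiv_observation_eq_zero hX hG hv hk]
    have h1 : G ∘ Takens.flow X (k * (1 / n : ℝ)) =
        (fun q => G (Takens.flow X (k * (1 / n : ℝ) - n) q)) ∘ Takens.flow X n := by
      funext q
      simp only [Function.comp_apply]
      rw [← Takens.flow_add hX, sub_add_cancel]
    rw [h1]
    exact (mvfderiv_comp_apply p ((hGd _).comp _ (Takens.mdifferentiable_flow hX _ _))
      (Takens.mdifferentiable_flow hX n p) v).symm
  · refine ((Takens.contMDiff_takensMap hX hG _ _).continuous.isClosedEmbedding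
      fun p q hpq => ?_).isEmbedding
    by_contra hne
    have hne' : Takens.flow X n p ≠ Takens.flow X n q := fun h0 => hne (by
      have := congrArg (Takens.flow X (-n)) h0
      rwa [← Takens.flow_add hX, ← Takens.flow_add hX, neg_add_cancel, Takens.flow_zero hX,
        Takens.flow_zero hX] at this)
    obtain ⟨t, ⟨k, hk, rfl⟩, ht⟩ := hinj _ _ hne'
    refine ht ?_
    simp only
    rw [← Takens.flow_add hX, ← Takens.flow_add hX, sub_add_cancel]
    exact congrArg (fun y : EuclideanSpace ℝ (Fin (2 * n ^ 2 + 1)) =>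
      y (⟨k, Nat.lt_succ_of_le hk⟩ : Fin (2 * n ^ 2 + 1))) hpq
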